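/- \textbf{Setting.} Let $k=\mathbb C$ or $\mathbb R$, and let $A$ be a finite-dimensional associative unital $k$-algebra with basis $(e_a)_{a\in S}$ and a linear form $\varepsilon\colon A\to k$ such that the bilinear form $(x,y)\mapsto\varepsilon(xy)$ is non-degenerate and symmetric. Let $(B^{ab})$ be the inverse of the matrix $(\varepsilon(e_ae_b))_{a,b\in S}$, and let $\beta=\sum_{a,b}B^{ab}e_ae_b$. Suppose that $A$ is special: $R\beta=1$ for some $R\in k\setminus\{0\}$. Put $C_{abc}=\varepsilon(e_ae_be_c)$. Let $M$ be a closed oriented triangulated surface, presented by finitely many oriented triangles whose sides are glued in pairs, coherently with the orientations (degenerate triangulations are allowed). Let $V,E,F$ be its numbers of vertices, edges and triangles. The state sum of $M$ is $$Z(M)=R^{V}\sum_{\text{states}}\ \prod_{\text{triangles}}C_{abc}\ \prod_{\text{edges}}B^{ab},$$ where a state assigns an element of $S$ to each side of each triangle, $a,b,c$ are the states on the three sides of a triangle in the cyclic order given by its orientation, and $a,b$ are the states on the two sides glued along an edge. We say that $M$ is a triangulation of the surface $\Sigma_g$ of genus $g\ge 0$ if $M$ is non-empty and connected and $V-E+F=2-2g$.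 \textbf{Theorem.} (i) If $k=\mathbb C$, then $A\cong\bigoplus_{i=1}^N\mathbb M_{n_i}(\mathbb C)$ as a $\mathbb C$-algebra for some $N\ge 0$ and $n_i\ge 1$. For every such decomposition, every $g\ge 0$ and every triangulation $M$ of $\Sigma_g$, $$Z(M)=R^{2-2g}\sum_{i=1}^N n_i^{2-2g}.$$ (ii) If $k=\mathbb R$, then $A\cong\bigoplus_{i=1}^N\mathbb M_{n_i}(D_i)$ as an $\mathbb R$-algebra for some $N\ge 0$, $n_i\ge 1$ and $D_i\in\{\mathbb R,\mathbb C,\mathbb H\}$ (regarded as $\mathbb R$-algebras). For every such decomposition, every $g\ge 0$ and every triangulation $M$ of $\Sigma_g$, $$Z(M)=R^{2-2g}\sum_{i=1}^N f(i,g)\,n_i^{2-2g},\qquad f(i,g)=\begin{cases}1&(D_i=\mathbb R)\\ 2&(D_i=\mathbb C)\\ 2^{2-2g}&(D_i=\mathbb H).\end{cases}$$ In particular $Z(M)$ depends only on $g$, and not on the triangulation $M$ of $\Sigma_g$ or on its orientation. -/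

import Mathlib

namespace StateSum

/-! ### Closed oriented triangulated surfaces -/

/-- A triangulation (possibly degenerate) of a closed oriented surface with set of triangles `T`.
The sides of an oriented triangle `t` are `(t, 0), (t, 1), (t, 2)` in the cyclic order given by the
orientation; side `(t, i)` runs from corner `(t, i)` to corner `(t, i + 1)`. The sides are glued in
pairs, each side to a different one with its direction reversed, so that the
orientations of the triangles are coherent. -/
structure TriangulatedSurface (T : Type*) where
  /-- the side to which a given side is glued -/
  glue : T × Fin 3 → T × Fin 3
  glue_glue : ∀ s, glue (glue s) = s
  glue_ne : ∀ s, glue s ≠ s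

namespace TriangulatedSurface

variable {T : Type*} (M : TriangulatedSurface T)

/-- The starting corner of the side `s` is identified with the end corner of `glue s`. (The end
corner of `s` and the starting corner of `glue s` are identified by this rule for `glue s`.) -/
def CornerRel (c c' : T × Fin 3) : Prop :=
  c' = ((M.glue c).1, (M.glue c).2 + 1)

/-- The vertices: the classes of corners under the identifications made by the gluing. -/
def Vertex : Type _ := Quot M.CornerRel

/-- The number of vertices. -/
noncomputable def numVertices : ℕ := Nat.card M.Vertex

open Classical in
/-- The edges: the unordered pairs of sides that are glued together. -/
noncomputable def edges [Fintype T] : Finset (Sym2 (T × Fin 3)) :=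
  Finset.univ.image fun s => s(s, M.glue s)

/-- The Euler characteristic `V - E + F`. -/
noncomputable def eulerChar [Fintype T] : ℤ :=
  (M.numVertices : ℤ) - (M.edges.card : ℤ) + (Fintype.card T : ℤ)

/-- Two triangles are adjacent if a side of the first is glued to a side of the second. -/
def Adjacent (t t' : T) : Prop := ∃ i j, M.glue (t, i) = (t', j)

/-- The surface is connected (and nonempty). -/
def Connected : Prop := Nonempty T ∧ ∀ t t', Relation.ReflTransGen M.Adjacent t t'

/-- The surface is the connected closed oriented surface of genus `g`. -/
def IsGenus [Fintype T] (g : ℕ) : Prop := M.Connected ∧ M.eulerChar = 2 - 2 * (g : ℤ)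

end TriangulatedSurface

/-! ### Naive state sum models -/

/-- The data of a naive state sum model with set of states `S`: triangle amplitudes `C`, invariant
under rotations, symmetric edge amplitudes `B`, and a vertex amplitude `R`. -/
structure NaiveData (k S : Type*) where
  C : S → S → S → k
  B : S → S → k
  R : k
  C_cyclic : ∀ a b c, C a b c = C b c a
  B_symm : ∀ a b, B a b = B b a

open Classical in
/-- The partition function of a closed oriented triangulated surface: every side of every triangle
carries a state; an edge contributes `B` of the states on its two sides. -/
noncomputable def NaiveData.partitionFunction {k S T : Type*} [CommRing k] [Fintype S] [Fintype T]
    (X : NaiveData k S) (M : TriangulatedSurface T) : k :=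
  X.R ^ M.numVertices * ∑ σ : T × Fin 3 → S,
    ((∏ t : T, X.C (σ (t, 0)) (σ (t, 1)) (σ (t, 2))) *
      ∏ E ∈ M.edges, Sym2.lift ⟨fun s s' => X.B (σ s) (σ s'), fun _ _ => X.B_symm _ _⟩ E)

/-! ### Symmetric special Frobenius algebras -/

section Frobenius

variable {k A S : Type*} [Field k] [Ring A] [Algebra k A] [Fintype S] [DecidableEq S]

/-- The matrix `B_{ab} = ε(e_a e_b)` of the bilinear form `ε ∘ m`. -/
noncomputable def gram (e : Module.Basis S k A) (ε : A →ₗ[k] k) : Matrix S S k :=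
  Matrix.of fun a b => ε (e a * e b)

/-- The distinguished element `β = m(B) = B^{ab} e_a e_b`, where `(B^{ab})` is the inverse of
the matrix of `ε ∘ m`. -/
noncomputable def distinguished (e : Module.Basis S k A) (ε : A →ₗ[k] k) : A :=
  ∑ a, ∑ b, (gram e ε)⁻¹ a b • (e a * e b)

/-- The finite-dimensional algebra `A`, with finite basis `e`, is a symmetric special Frobenius
algebra with Frobenius form `ε`, and the nonzero constant `R` is normalised by `R β = 1`. -/
structure IsSymmetricSpecialFrobenius (e : Module.Basis S k A) (ε : A →ₗ[k] k) (R : k) : Prop where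
  nondegenerate : ∀ x, (∀ y, ε (x * y) = 0) → x = 0
  symmetric : ∀ x y, ε (x * y) = ε (y * x)
  R_ne_zero : R ≠ 0
  special : R • distinguished e ε = 1

/-- The state sum data of a symmetric special Frobenius algebra with basis `e`:
`C_{abc} = ε(e_a e_b e_c)`, and `B^{ab}` is the inverse of the matrix `ε(e_a e_b)`. -/
noncomputable def IsSymmetricSpecialFrobenius.data {e : Module.Basis S k A} {ε : A →ₗ[k] k} {R : k}
    (h : IsSymmetricSpecialFrobenius e ε R) : NaiveData k S where
  C a b c := ε (e a * e b * e c)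
  B a b := (gram e ε)⁻¹ a b
  R := R
  C_cyclic a b c := by rw [mul_assoc, h.symmetric]
  B_symm a b := by
    have hs : (gram e ε).transpose = gram e ε := by
      ext i j
      exact h.symmetric _ _
    have ht : ((gram e ε)⁻¹).transpose = (gram e ε)⁻¹ := by
      rw [Matrix.transpose_nonsing_inv, hs]
    exact congrFun (congrFun ht b) a

end Frobenius

/-! ### Direct sums of matrix algebras -/

/-- Labels of the division rings `ℝ`, `ℂ`, `ℍ`. -/
inductive DivType
  | real
  | complex
  | quaternion

/-- The division ring with a given label. -/
def DivType.Carrier : DivType → Type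
  | real => ℝ
  | complex => ℂ
  | quaternion => Quaternion ℝ

noncomputable instance : (d : DivType) → DivisionRing d.Carrier
  | .real => inferInstanceAs (DivisionRing ℝ)
  | .complex => inferInstanceAs (DivisionRing ℂ)
  | .quaternion => inferInstanceAs (DivisionRing (Quaternion ℝ))

/-- `ℝ`, `ℂ` and `ℍ` as algebras over `ℝ`. -/
noncomputable instance : (d : DivType) → Algebra ℝ d.Carrier
  | .real => inferInstanceAs (Algebra ℝ ℝ)
  | .complex => inferInstanceAs (Algebra ℝ ℂ)
  | .quaternion => inferInstanceAs (Algebra ℝ (Quaternion ℝ))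

/-- The factor `f(i, g)`, as a function of the division ring `D_i` and the genus. -/
noncomputable def DivType.factor (g : ℕ) : DivType → ℝ
  | real => 1
  | complex => 2
  | quaternion => 2 ^ (2 - 2 * (g : ℤ))

/-- `A ≅ ⨁ i, M_{n i}(ℂ)` with all `n i ≥ 1`. -/
def IsComplexDecomposition (A : Type*) [Ring A] [Algebra ℂ A] {N : ℕ} (n : Fin N → ℕ) : Prop :=
  (∀ i, 1 ≤ n i) ∧ Nonempty (A ≃ₐ[ℂ] ((i : Fin N) → Matrix (Fin (n i)) (Fin (n i)) ℂ))

/-- `A ≅ ⨁ i, M_{n i}(D i)` with all `n i ≥ 1`. -/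
def IsRealDecomposition (A : Type*) [Ring A] [Algebra ℝ A] {N : ℕ} (n : Fin N → ℕ)
    (D : Fin N → DivType) : Prop :=
  (∀ i, 1 ≤ n i) ∧
    Nonempty (A ≃ₐ[ℝ] ((i : Fin N) → Matrix (Fin (n i)) (Fin (n i)) (D i).Carrier))

end StateSum

/-! Specialness forces `ε x = R * tr(L_x)`, where `L_x` is left multiplication. Hence `ε` kills
nilpotent elements, and non-degeneracy makes the Jacobson radical vanish (`isSemisimpleRing`).
Wedderburn's theorem then decomposes `A`; over `ℝ` it is combined with Frobenius' classification of
division algebras (`exists_algEquiv_divType`).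

To evaluate the state sum on a sum of full matrix algebras of sizes `n_i`, replace the basis by
matrix entries (`partitionFunction_eq_changeStates`). With `w_i = R * n_i`, a triangle amplitude
becomes `w_i` times Kronecker deltas at the corners, and an edge amplitude `w_i⁻¹` times deltas at
the ends. On a connected surface the surviving states are a block `i` with a label in `Fin (n_i)` at
each vertex: `n_i ^ V` states of weight `w_i ^ (F - E)`. With the factor `R ^ V` this gives `∑ w_i ^
(V - E + F)` (`partitionFunction_pi_matrix`).

Over `ℝ`, extend scalars: the state sum is unchanged, while `ℝ`, `ℂ`, `ℍ` become `ℂ`, `ℂ × ℂ`,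
`M_2(ℂ)`. The number and size of these blocks produce `f(i, g)`. -/

namespace StateSum

/-! ### Edges as pairs of sides -/

namespace TriangulatedSurface

variable {T : Type*} [Fintype T] (M : TriangulatedSurface T)

/-- A chosen side of an edge. -/
noncomputable def side (E : M.edges) : T × Fin 3 := (Quot.out E.1).1

theorem mk_mem_edges (s : T × Fin 3) : s(s, M.glue s) ∈ M.edges := by
  classical
  simp only [edges, Finset.mem_image, Finset.mem_univ, true_and]
  exact ⟨s, rfl⟩

theorem mk_side (E : M.edges) : s(M.side E, M.glue (M.side E)) = E.1 := by
  classical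
  obtain ⟨E, hE⟩ := E
  have h : Quot.mk _ (Quot.out E) = E := Quot.out_eq E
  have hE' := hE
  simp only [edges, Finset.mem_image, Finset.mem_univ, true_and] at hE'
  obtain ⟨s, hs⟩ := hE'
  have h2 : s(s, M.glue s) = s((Quot.out E).1, (Quot.out E).2) := hs.trans h.symm
  have h3 : s((Quot.out E).1, (Quot.out E).2) = E := h
  change s((Quot.out E).1, M.glue (Quot.out E).1) = E
  rw [Sym2.eq_iff] at h2
  rcases h2 with ⟨h4, h5⟩ | ⟨h4, h5⟩
  · rw [← h4, hs]
  · rw [← h5, M.glue_glue, Sym2.eq_swap, hs]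

theorem side_mk (s : T × Fin 3) :
    M.side ⟨_, M.mk_mem_edges s⟩ = s ∨ M.glue (M.side ⟨_, M.mk_mem_edges s⟩) = s := by
  have h := M.mk_side ⟨_, M.mk_mem_edges s⟩
  rw [Sym2.eq_iff] at h
  rcases h with h | h
  · exact Or.inl h.1
  · exact Or.inr h.2

/-- Every edge has two sides, and every side belongs to exactly one edge. -/
noncomputable def sidesEquiv : M.edges ⊕ M.edges ≃ T × Fin 3 :=
  Equiv.ofBijective (Sum.elim M.side fun E => M.glue (M.side E)) <| by
    constructor
    · have key : ∀ E E' : M.edges, (M.side E = M.side E' ∨ M.side E = M.glue (M.side E')) →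
          E = E' := by
        rintro E E' (h | h) <;> apply Subtype.ext <;> rw [← M.mk_side E, ← M.mk_side E', h]
        rw [M.glue_glue, Sym2.eq_swap]
      rintro (E | E) (E' | E') h <;> simp only [Sum.elim_inl, Sum.elim_inr] at h
      · rw [key E E' (Or.inl h)]
      · obtain rfl := key E E' (Or.inr h)
        exact absurd h.symm (M.glue_ne _)
      · obtain rfl := key E' E (Or.inr h.symm)
        exact absurd h (M.glue_ne _)
      · rw [key E E' (Or.inl ?_)]
        rw [← M.glue_glue (M.side E), h, M.glue_glue]
    · intro s
      rcases M.side_mk s with h | h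
      · exact ⟨Sum.inl _, h⟩
      · exact ⟨Sum.inr _, h⟩

@[simp] theorem sidesEquiv_inl (E : M.edges) : M.sidesEquiv (Sum.inl E) = M.side E := rfl

@[simp] theorem sidesEquiv_inr (E : M.edges) :
    M.sidesEquiv (Sum.inr E) = M.glue (M.side E) := rfl

variable {k S : Type*} [CommRing k]

theorem prod_sides (f : T × Fin 3 → k) :
    ∏ s, f s = ∏ E : M.edges, f (M.side E) * f (M.glue (M.side E)) := by
  rw [← M.sidesEquiv.prod_comp, Fintype.prod_sum_type, ← Finset.prod_mul_distrib]
  rfl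

/-- The sides are partitioned into edges, so a state amounts to an independent pair `(a, b)` for
each edge, and the sum distributes over the product. -/
theorem sum_prod_edges [Fintype S] [DecidableEq T] (G : M.edges → S → S → k) :
    ∑ σ : T × Fin 3 → S, ∏ E : M.edges, G E (σ (M.side E)) (σ (M.glue (M.side E))) =
      ∏ E : M.edges, ∑ a, ∑ b, G E a b := by
  classical
  rw [← ((Equiv.arrowCongr M.sidesEquiv (Equiv.refl S)).symm.trans
    (Equiv.sumArrowEquivProdArrow _ _ _)).symm.sum_comp, Fintype.sum_prod_type,
    Fintype.prod_sum]
  refine Finset.sum_congr rfl fun f _ => ?_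
  rw [Fintype.prod_sum]
  refine Finset.sum_congr rfl fun g _ => Finset.prod_congr rfl fun E _ => ?_
  rw [← M.sidesEquiv_inr, ← M.sidesEquiv_inl]
  simp [Equiv.sumArrowEquivProdArrow, -sidesEquiv_inl, -sidesEquiv_inr]

end TriangulatedSurface

/-! ### Change of states in a state sum -/

/-- The triangle amplitudes of a state sum, expanded over states of the sides. -/
theorem prod_sum_triangles {T k S : Type*} [Fintype T] [DecidableEq T] [CommRing k] [Fintype S]
    (G : T → S → S → S → k) :
    ∏ t, ∑ x, ∑ y, ∑ z, G t x y z =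
      ∑ τ : T × Fin 3 → S, ∏ t, G t (τ (t, 0)) (τ (t, 1)) (τ (t, 2)) := by
  classical
  rw [← (Equiv.curry T (Fin 3) S).symm.sum_comp]
  have h : ∀ t, ∑ x, ∑ y, ∑ z, G t x y z = ∑ v : Fin 3 → S, G t (v 0) (v 1) (v 2) := by
    intro t
    rw [← (Fin.consEquiv fun _ : Fin 3 => S).sum_comp, Fintype.sum_prod_type]
    refine Finset.sum_congr rfl fun x _ => ?_
    rw [← (Fin.consEquiv fun _ : Fin 2 => S).sum_comp, Fintype.sum_prod_type]
    refine Finset.sum_congr rfl fun y _ => ?_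
    rw [← (Equiv.funUnique (Fin 1) S).symm.sum_comp]
    rfl
  simp_rw [h]
  rw [Fintype.prod_sum]
  rfl

theorem NaiveData.partitionFunction_eq {k S T : Type*} [CommRing k] [Fintype S] [Fintype T]
    [DecidableEq T] (X : NaiveData k S) (M : TriangulatedSurface T) :
    X.partitionFunction M = X.R ^ M.numVertices * ∑ σ : T × Fin 3 → S,
      ((∏ t : T, X.C (σ (t, 0)) (σ (t, 1)) (σ (t, 2))) *
        ∏ E : M.edges, X.B (σ (M.side E)) (σ (M.glue (M.side E)))) := by
  rw [partitionFunction]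
  congr 1
  convert rfl using 4 with σ _
  rw [← Finset.prod_coe_sort M.edges]
  refine Finset.prod_congr rfl fun E _ => ?_
  conv_rhs => rw [← M.mk_side E]
  rfl

/-- Rewriting a state sum in terms of a second set of states: the triangle amplitudes transform
by `P`, and the edge amplitudes by its transpose. -/
theorem NaiveData.partitionFunction_eq_changeStates {k S S' T : Type*} [CommRing k] [Fintype S]
    [Fintype S'] [Fintype T] [DecidableEq T] (X : NaiveData k S) (P : S → S' → k)
    (C : S' → S' → S' → k) (B : S' → S' → k)
    (hC : ∀ a b c, X.C a b c = ∑ x, ∑ y, ∑ z, P a x * P b y * P c z * C x y z)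
    (hB : ∀ x y, B x y = ∑ a, ∑ b, P a x * P b y * X.B a b) (M : TriangulatedSurface T) :
    X.partitionFunction M = X.R ^ M.numVertices * ∑ τ : T × Fin 3 → S',
      ((∏ t : T, C (τ (t, 0)) (τ (t, 1)) (τ (t, 2))) *
        ∏ E : M.edges, B (τ (M.side E)) (τ (M.glue (M.side E)))) := by
  rw [X.partitionFunction_eq M]
  congr 1
  simp_rw [hC, prod_sum_triangles, Finset.sum_mul]
  -- For a fixed new state `τ`, the sum over the old states `σ` factorises over the edges, and each
  -- factor is the transformed edge amplitude.
  rw [Finset.sum_comm]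
  refine Finset.sum_congr rfl fun τ _ => ?_
  simp_rw [hB]
  rw [← M.sum_prod_edges fun E a b =>
    P a (τ (M.side E)) * P b (τ (M.glue (M.side E))) * X.B a b, Finset.mul_sum]
  refine Finset.sum_congr rfl fun σ _ => ?_
  -- Each side contributes `P` exactly once, whether the sides are grouped by edges or by triangles.
  rw [Finset.prod_mul_distrib, Finset.prod_mul_distrib (f := fun E : M.edges => _ * _),
    ← M.prod_sides fun s => P (σ s) (τ s), Fintype.prod_prod_type]
  simp_rw [Fin.prod_univ_three]
  ring

/-! ### Special Frobenius algebras and semisimplicity -/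

section Frobenius

variable {k A S : Type*} [Field k] [Ring A] [Algebra k A] [Fintype S] [DecidableEq S]

omit [Fintype S] [DecidableEq S] in
theorem gram_apply (e : Module.Basis S k A) (ε : A →ₗ[k] k) (a b : S) :
    gram e ε a b = ε (e a * e b) := rfl

omit [DecidableEq S] in
theorem vecMul_gram (e : Module.Basis S k A) (ε : A →ₗ[k] k) (v : S → k) (b : S) :
    Matrix.vecMul v (gram e ε) b = ε ((∑ a, v a • e a) * e b) := by
  simp [Matrix.vecMul, dotProduct, gram_apply, Finset.sum_mul]

/-- The form `ε (x y)` is non-degenerate if and only if its matrix is invertible. -/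
theorem nondegenerate_iff_isUnit_gram (e : Module.Basis S k A) (ε : A →ₗ[k] k) :
    (∀ x, (∀ y, ε (x * y) = 0) → x = 0) ↔ IsUnit (gram e ε) := by
  rw [← Matrix.vecMul_injective_iff_isUnit]
  constructor
  · intro h
    rw [← Matrix.coe_vecMulLinear, ← LinearMap.ker_eq_bot, LinearMap.ker_eq_bot']
    intro v hv
    have h0 : ∑ a, v a • e a = 0 := by
      refine h _ fun y => ?_
      rw [← e.sum_repr y, Finset.mul_sum, map_sum]
      refine Finset.sum_eq_zero fun b _ => ?_
      rw [mul_smul_comm, map_smul, ← vecMul_gram]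
      have := congrFun hv b
      simp only [Matrix.coe_vecMulLinear] at this
      rw [this]; simp
    funext a
    exact Fintype.linearIndependent_iff.1 e.linearIndependent v h0 a
  · intro h x hx
    have h0 : (⇑(e.repr x) : S → k) = 0 := by
      apply h
      funext b
      simp only [Matrix.zero_vecMul]
      rw [vecMul_gram, e.sum_repr, hx]; rfl
    apply e.repr.injective
    ext a
    simp [congrFun h0 a]

namespace IsSymmetricSpecialFrobenius

variable {e : Module.Basis S k A} {ε : A →ₗ[k] k} {R : k}

theorem isUnit_gram (h : IsSymmetricSpecialFrobenius e ε R) : IsUnit (gram e ε) :=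
  (nondegenerate_iff_isUnit_gram e ε).1 h.nondegenerate

/-- Coordinates with respect to the basis, by means of the dual basis. -/
theorem repr_eq (h : IsSymmetricSpecialFrobenius e ε R) (x : A) (a : S) :
    e.repr x a = ∑ b, (gram e ε)⁻¹ a b * ε (e b * x) := by
  have h1 : ∀ b, ε (e b * x) = Matrix.mulVec (gram e ε) (e.repr x) b := by
    intro b
    conv_lhs => rw [← e.sum_repr x]
    simp [-Module.Basis.sum_repr, Matrix.mulVec, dotProduct, gram_apply, Finset.mul_sum, mul_comm]
  have h2 : Matrix.mulVec (gram e ε)⁻¹ (Matrix.mulVec (gram e ε) (e.repr x)) a = e.repr x a := by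
    rw [Matrix.mulVec_mulVec, Matrix.nonsing_inv_mul _ ((Matrix.isUnit_iff_isUnit_det _).1
      h.isUnit_gram), Matrix.one_mulVec]
  rw [← h2]
  simp_rw [h1]
  rfl

theorem sum_smul_eq (h : IsSymmetricSpecialFrobenius e ε R) (x : A) :
    ∑ a, ∑ b, ((gram e ε)⁻¹ a b * ε (e b * x)) • e a = x := by
  simp_rw [← Finset.sum_smul, ← h.repr_eq, e.sum_repr]

/-- The Frobenius form of a special Frobenius algebra is a multiple of the trace of the regular
representation. -/
theorem form_eq_trace (h : IsSymmetricSpecialFrobenius e ε R) (x : A) :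
    ε x = R * LinearMap.trace k A (LinearMap.mulLeft k x) := by
  -- The coefficient of `e a` in `x * e a` is `∑ b, B^{ab} ε(e_b x e_a)`; by symmetry of `ε` these
  -- add up to `ε(x β)`.
  have h1 : LinearMap.trace k A (LinearMap.mulLeft k x) = ε (x * distinguished e ε) := by
    rw [LinearMap.trace_eq_matrix_trace k e, Matrix.trace, distinguished, Finset.mul_sum, map_sum]
    refine Finset.sum_congr rfl fun a _ => ?_
    rw [Matrix.diag_apply, LinearMap.toMatrix_apply, h.repr_eq, Finset.mul_sum, map_sum]
    refine Finset.sum_congr rfl fun b _ => ?_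
    rw [mul_smul_comm, map_smul, h.symmetric, LinearMap.mulLeft_apply, smul_eq_mul, mul_assoc]
  rw [h1, ← smul_eq_mul, ← map_smul, ← mul_smul_comm, h.special, mul_one]

/-- For `x` in the Jacobson radical, every `x * y` is nilpotent, so its regular trace, and with it
`ε (x * y)`, is zero; non-degeneracy gives `x = 0`. -/
theorem isSemisimpleRing (h : IsSymmetricSpecialFrobenius e ε R) : IsSemisimpleRing A := by
  have : Module.Finite k A := Module.Finite.of_basis e
  have : IsArtinianRing A := IsArtinianRing.of_finite k A
  rw [IsArtinianRing.isSemisimpleRing_iff_jacobson, eq_bot_iff]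
  intro x hx
  obtain ⟨n, hn⟩ := IsArtinianRing.isNilpotent_jacobson_bot (R := A)
  refine h.nondegenerate x fun y => ?_
  have hxy : x * y ∈ Ring.jacobson A := Ideal.mul_mem_right _ _ hx
  have hnil : IsNilpotent (x * y) := by
    refine ⟨n, ?_⟩
    have := Ideal.pow_mem_pow hxy n
    rw [← Ideal.jacobson_bot, hn] at this
    exact this
  rw [h.form_eq_trace]
  have h2 : IsNilpotent (LinearMap.mulLeft k (x * y)) := by
    obtain ⟨m, hm⟩ := hnil
    exact ⟨m, by rw [LinearMap.pow_mulLeft, hm, LinearMap.mulLeft_zero_eq_zero]⟩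
  rw [(LinearMap.isNilpotent_trace_of_isNilpotent h2).eq_zero, mul_zero]

/-! ### Extension of scalars -/

section BaseChange

variable {K P : Type*} [Field K] [Ring P] [Algebra K P] [Algebra k K] [Algebra k P]
  [IsScalarTower k K P]

/-- The Frobenius form on `P` that extends the one on `A`, when a basis of `A` over `k` is mapped
to a basis of `P` over `K`. -/
noncomputable def extendForm (ε : A →ₗ[k] k) (e : Module.Basis S k A) (e' : Module.Basis S K P) :
    P →ₗ[K] K :=
  e'.constr K fun a => algebraMap k K (ε (e a))

variable {e' : Module.Basis S K P} {ψ : A →ₐ[k] P}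

theorem extendForm_apply (hψ : ∀ a, ψ (e a) = e' a) (x : A) :
    extendForm ε e e' (ψ x) = algebraMap k K (ε x) := by
  have h : ((extendForm ε e e').restrictScalars k).comp ψ.toLinearMap =
      (Algebra.linearMap k K).comp ε := by
    refine e.ext fun a => ?_
    simp only [LinearMap.comp_apply, AlgHom.toLinearMap_apply, LinearMap.restrictScalars_apply,
      hψ, Algebra.linearMap_apply]
    simp [extendForm]
  exact LinearMap.congr_fun h x

theorem gram_extendForm (hψ : ∀ a, ψ (e a) = e' a) :
    gram e' (extendForm ε e e') = (gram e ε).map (algebraMap k K) := by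
  ext a b
  rw [Matrix.map_apply, gram_apply, gram_apply, ← hψ, ← hψ, ← map_mul, extendForm_apply hψ]

theorem inv_gram_extendForm (h : IsSymmetricSpecialFrobenius e ε R) (hψ : ∀ a, ψ (e a) = e' a) :
    (gram e' (extendForm ε e e'))⁻¹ = (gram e ε)⁻¹.map (algebraMap k K) := by
  apply Matrix.inv_eq_right_inv
  rw [gram_extendForm hψ, ← Matrix.map_mul, Matrix.mul_nonsing_inv _
    ((Matrix.isUnit_iff_isUnit_det _).1 h.isUnit_gram)]
  simp

/-- All conditions can be tested on the basis, where the form and the products are the images of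
those of `A`. The case `K = k` transports the structure along an isomorphism. -/
theorem extend (h : IsSymmetricSpecialFrobenius e ε R) (hψ : ∀ a, ψ (e a) = e' a) :
    IsSymmetricSpecialFrobenius e' (extendForm ε e e') (algebraMap k K R) where
  nondegenerate := by
    rw [nondegenerate_iff_isUnit_gram e', gram_extendForm hψ]
    exact h.isUnit_gram.map (algebraMap k K).mapMatrix
  symmetric x y := by
    have : (LinearMap.mul K P).compr₂ (extendForm ε e e') =
        ((LinearMap.mul K P).compr₂ (extendForm ε e e')).flip := by
      refine e'.ext fun a => e'.ext fun b => ?_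
      simp only [LinearMap.compr₂_apply, LinearMap.flip_apply, LinearMap.mul_apply']
      rw [← hψ a, ← hψ b, ← map_mul ψ, ← map_mul ψ, extendForm_apply hψ, extendForm_apply hψ,
        h.symmetric]
    exact LinearMap.congr_fun (LinearMap.congr_fun this x) y
  R_ne_zero := by simpa using h.R_ne_zero
  special := by
    have : distinguished e' (extendForm ε e e') = ψ (distinguished e ε) := by
      simp only [distinguished, map_sum, map_smul, map_mul, hψ, h.inv_gram_extendForm hψ,
        Matrix.map_apply, algebraMap_smul]
    rw [this, algebraMap_smul, ← map_smul, h.special, map_one]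

theorem partitionFunction_extend (h : IsSymmetricSpecialFrobenius e ε R)
    (hψ : ∀ a, ψ (e a) = e' a) {T : Type*} [Fintype T] (M : TriangulatedSurface T) :
    (h.extend hψ).data.partitionFunction M = algebraMap k K (h.data.partitionFunction M) := by
  classical
  rw [NaiveData.partitionFunction_eq, NaiveData.partitionFunction_eq, map_mul, map_pow, map_sum]
  congr 1
  refine Finset.sum_congr rfl fun σ _ => ?_
  rw [map_mul, map_prod, map_prod]
  congr 1
  · refine Finset.prod_congr rfl fun t _ => ?_
    change extendForm ε e e' (e' _ * e' _ * e' _) = algebraMap k K (ε _)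
    rw [← hψ, ← hψ, ← hψ, ← map_mul, ← map_mul, extendForm_apply hψ]
  · refine Finset.prod_congr rfl fun E _ => ?_
    change (gram e' (extendForm ε e e'))⁻¹ _ _ = algebraMap k K ((gram e ε)⁻¹ _ _)
    rw [h.inv_gram_extendForm hψ, Matrix.map_apply]

end BaseChange

end IsSymmetricSpecialFrobenius

end Frobenius

/-! ### Frobenius forms on sums of matrix algebras -/

section PiMatrix

variable {k ι : Type*} [Field k] [Fintype ι] [DecidableEq ι] {J : ι → Type*}
  [∀ i, Fintype (J i)] [∀ i, DecidableEq (J i)]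

/-- The trace of the regular representation of a direct sum of matrix algebras. -/
theorem trace_mulLeft_pi_matrix (x : ∀ i, Matrix (J i) (J i) k) :
    LinearMap.trace k _ (LinearMap.mulLeft k x) = ∑ i, (Fintype.card (J i) : k) * (x i).trace := by
  rw [LinearMap.trace_eq_matrix_trace k (Pi.basis fun i => Matrix.stdBasis k (J i) (J i)),
    Matrix.trace, Fintype.sum_sigma]
  refine Finset.sum_congr rfl fun i _ => ?_
  rw [Fintype.sum_prod_type, Matrix.trace, Finset.mul_sum]
  refine Finset.sum_congr rfl fun p _ => ?_
  -- Multiplying the matrix unit `E_{pq}` by `x i` gives it the coefficient `x i p p`. This does not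
  -- depend on `q`, which is where the factor `card (J i)` comes from.
  have : ∀ q, Matrix.diag (LinearMap.toMatrix (Pi.basis fun i => Matrix.stdBasis k (J i) (J i))
      (Pi.basis fun i => Matrix.stdBasis k (J i) (J i)) (LinearMap.mulLeft k x)) ⟨i, p, q⟩ =
        x i p p := by
    intro q
    rw [Matrix.diag_apply, LinearMap.toMatrix_apply, Pi.basis_repr, Pi.basis_apply]
    rw [Matrix.stdBasis_eq_single, LinearMap.mulLeft_apply, Pi.mul_apply, Pi.single_eq_same]
    change (x i * Matrix.single p q 1 : Matrix (J i) (J i) k) p q = x i p p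
    simp
  simp only [this, Finset.sum_const, Finset.card_univ, nsmul_eq_mul, Matrix.diag_apply]

/-- The Frobenius form on a direct sum of matrix algebras, by matrix traces. -/
theorem IsSymmetricSpecialFrobenius.form_pi_matrix {S : Type*} [Fintype S] [DecidableEq S]
    {e : Module.Basis S k (∀ i, Matrix (J i) (J i) k)} {ε R}
    (h : IsSymmetricSpecialFrobenius e ε R) (x : ∀ i, Matrix (J i) (J i) k) :
    ε x = ∑ i, R * (Fintype.card (J i) : k) * (x i).trace := by
  rw [h.form_eq_trace, trace_mulLeft_pi_matrix, Finset.mul_sum]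
  simp_rw [mul_assoc]

theorem IsSymmetricSpecialFrobenius.form_eq_sum_blockDiagonal {S : Type*} [Fintype S]
    [DecidableEq S] {e : Module.Basis S k (∀ i, Matrix (J i) (J i) k)} {ε R}
    (h : IsSymmetricSpecialFrobenius e ε R) (x : ∀ i, Matrix (J i) (J i) k) :
    ε x = ∑ u : Σ i, J i, R * (Fintype.card (J u.1) : k) * Matrix.blockDiagonal' x u u := by
  rw [h.form_pi_matrix, Fintype.sum_sigma]
  refine Finset.sum_congr rfl fun i _ => ?_
  simp [Matrix.trace, Finset.mul_sum, Matrix.blockDiagonal'_apply_eq]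

/-- The edge amplitudes of a direct sum of matrix algebras in terms of matrix entries. -/
theorem IsSymmetricSpecialFrobenius.sum_blockDiagonal_mul {S : Type*} [Fintype S] [DecidableEq S]
    [CharZero k] [∀ i, Nonempty (J i)]
    {e : Module.Basis S k (∀ i, Matrix (J i) (J i) k)} {ε R}
    (h : IsSymmetricSpecialFrobenius e ε R) (p q s t : Σ i, J i) :
    ∑ a, ∑ b, Matrix.blockDiagonal' (e a) p q * Matrix.blockDiagonal' (e b) s t *
        (gram e ε)⁻¹ a b =
      if p = t ∧ q = s ∧ p.1 = q.1 then (R * (Fintype.card (J p.1) : k))⁻¹ else 0 := by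
  obtain ⟨j, s⟩ := s
  obtain ⟨j', t⟩ := t
  by_cases hj : j = j'
  · subst hj
    have hw : R * (Fintype.card (J j) : k) ≠ 0 :=
      mul_ne_zero h.R_ne_zero (Nat.cast_ne_zero.2 Fintype.card_ne_zero)
    -- Pairing with the matrix unit `E_{ts}` reads off the entry `(s, t)` up to the factor `w_j`.
    -- The entry `(p, q)` of the dual basis expansion of `E_{ts}` is therefore the required sum
    -- times `w_j`.
    have h1 : ∀ b, ε (e b * Pi.single j (Matrix.single t s 1)) =
        R * (Fintype.card (J j) : k) * (e b) j s t := by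
      intro b
      rw [h.form_pi_matrix, Finset.sum_eq_single j]
      · simp [Matrix.trace_mul_single]
      · intro i _ hi
        simp [Pi.single_eq_of_ne hi]
      · simp
    have h2 := congrArg (fun x => Matrix.blockDiagonal' x p q)
      (h.sum_smul_eq (Pi.single j (Matrix.single t s 1)))
    have h3 : Matrix.blockDiagonal' (Pi.single j (Matrix.single t s (1 : k)) :
        ∀ i, Matrix (J i) (J i) k) p q =
        if p = ⟨j, t⟩ ∧ q = ⟨j, s⟩ then 1 else 0 := by
      obtain ⟨i, p⟩ := p
      obtain ⟨i', q⟩ := q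
      by_cases hi : i = i'
      · subst hi
        rw [Matrix.blockDiagonal'_apply_eq]
        by_cases hij : i = j
        · subst hij
          simp [Matrix.single_apply, eq_comm]
        · simp [hij]
      · rw [Matrix.blockDiagonal'_apply_ne _ _ _ hi, if_neg]
        rintro ⟨h5, h6⟩
        exact hi ((congrArg Sigma.fst h5).trans (congrArg Sigma.fst h6).symm)
    have h4 : ∑ a, ∑ b, Matrix.blockDiagonal' (e a) p q * (e b) j s t * (gram e ε)⁻¹ a b =
        (R * (Fintype.card (J j) : k))⁻¹ * if p = ⟨j, t⟩ ∧ q = ⟨j, s⟩ then 1 else 0 := by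
      rw [← h3, ← h2, eq_inv_mul_iff_mul_eq₀ hw, Finset.mul_sum]
      have h7 : ∀ x, Matrix.blockDiagonal' x p q =
          Matrix.blockDiagonal'AddMonoidHom J J k x p q := fun _ => rfl
      simp only [h7, map_sum, Matrix.sum_apply, h1]
      simp only [← h7]
      refine Finset.sum_congr rfl fun a _ => ?_
      rw [Finset.mul_sum]
      refine Finset.sum_congr rfl fun b _ => ?_
      rw [Matrix.blockDiagonal'_smul, Matrix.smul_apply, smul_eq_mul]
      ring
    simp only [Matrix.blockDiagonal'_apply_eq]
    rw [h4]
    by_cases hpq : p = ⟨j, t⟩ ∧ q = ⟨j, s⟩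
    · obtain ⟨rfl, rfl⟩ := hpq
      simp
    · rw [if_neg hpq, if_neg fun h5 => hpq ⟨h5.1, h5.2.1⟩, mul_zero]
  · rw [if_neg]
    · refine Finset.sum_eq_zero fun a _ => Finset.sum_eq_zero fun b _ => ?_
      rw [Matrix.blockDiagonal'_apply_ne _ _ _ hj, mul_zero, zero_mul]
    · rintro ⟨rfl, rfl, h5⟩
      exact hj h5.symm

end PiMatrix

/-! ### States coming from labellings of the vertices -/

namespace TriangulatedSurface

variable {T : Type*} (M : TriangulatedSurface T)

/-- The states of the sides that come from a labelling of the vertices by elements of one of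
the sets `J i`: a side carries the labels of its two ends. -/
def vertexStates {ι : Type*} {J : ι → Type*} (v : Σ i, M.Vertex → J i) (s : T × Fin 3) :
    (Σ i, J i) × (Σ i, J i) :=
  (⟨v.1, v.2 (Quot.mk _ s)⟩, ⟨v.1, v.2 (Quot.mk _ (s.1, s.2 + 1))⟩)

/-- Every vertex is the starting corner of some side, so the side states determine the labels. A
triangle is needed to recover the block `i` itself. -/
theorem vertexStates_injective [Nonempty T] {ι : Type*} {J : ι → Type*} :
    Function.Injective (M.vertexStates (J := J)) := by
  rintro ⟨i, v⟩ ⟨i', v'⟩ h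
  obtain ⟨t⟩ := ‹Nonempty T›
  have h1 : ∀ s, (⟨i, v (Quot.mk _ s)⟩ : Σ i, J i) = ⟨i', v' (Quot.mk _ s)⟩ := fun s =>
    congrArg Prod.fst (congrFun h s)
  obtain rfl : i = i' := congrArg Sigma.fst (h1 (t, 0))
  congr 1
  funext c
  induction c using Quot.ind with
  | mk s => simpa using h1 s

/-- States in which the labels of the sides agree at every corner of every triangle, and along
every edge, come from a labelling of the vertices. -/
theorem exists_vertexStates (hM : M.Connected) {ι : Type*} {J : ι → Type*}
    (τ : T × Fin 3 → (Σ i, J i) × (Σ i, J i))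
    (h1 : ∀ s : T × Fin 3, (τ s).2 = (τ (s.1, s.2 + 1)).1)
    (h2 : ∀ s, (τ (M.glue s)).2 = (τ s).1) (h3 : ∀ s, (τ s).1.1 = (τ s).2.1) :
    ∃ v, M.vertexStates v = τ := by
  obtain ⟨⟨t₀⟩, hc⟩ := hM
  have ht : ∀ (t : T) (j : Fin 3), (τ (t, j)).1.1 = (τ (t, 0)).1.1 := by
    intro t j
    have h01 := (h3 (t, 0)).trans (congrArg Sigma.fst (h1 (t, 0)))
    have h12 := (h3 (t, 1)).trans (congrArg Sigma.fst (h1 (t, 1)))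
    fin_cases j
    · rfl
    · exact h01.symm
    · exact h12.symm.trans h01.symm
  -- Connectedness enters here: the block is constant on each triangle and is passed on across each
  -- edge.
  have hadj : ∀ t, (τ (t, 0)).1.1 = (τ (t₀, 0)).1.1 := by
    intro t
    have := hc t₀ t
    induction this with
    | refl => rfl
    | tail _ hst ih =>
      obtain ⟨i, j, hij⟩ := hst
      rw [← ih, ← ht _ j, ← hij, h3, h2, ht]
  have hall : ∀ s, (τ s).1.1 = (τ (t₀, 0)).1.1 := fun s => (ht s.1 s.2).trans (hadj s.1)
  have hlab : ∀ s, ∃ x : J (τ (t₀, 0)).1.1, (τ s).1 = ⟨(τ (t₀, 0)).1.1, x⟩ := by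
    intro s
    have := hall s
    generalize (τ s).1 = u at this
    obtain ⟨i, x⟩ := u
    obtain rfl : i = _ := this
    exact ⟨x, rfl⟩
  choose v hv using hlab
  refine ⟨⟨_, Quot.lift v ?_⟩, ?_⟩
  · rintro s _ rfl
    have h4 : (τ ((M.glue s).1, (M.glue s).2 + 1)).1 = (τ s).1 := by rw [← h1, h2]
    simpa using ((hv _).symm.trans (h4.trans (hv s))).symm
  · funext s
    exact Prod.ext (hv s).symm ((h1 s).trans (hv _)).symm

end TriangulatedSurface

/-! ### The state sum of a sum of matrix algebras -/

theorem IsSymmetricSpecialFrobenius.partitionFunction_pi_matrix {k ι S T : Type*} [Field k]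
    [CharZero k] [Fintype ι] [DecidableEq ι] {J : ι → Type*} [∀ i, Fintype (J i)]
    [∀ i, DecidableEq (J i)] [∀ i, Nonempty (J i)] [Fintype S] [DecidableEq S] [Fintype T]
    {e : Module.Basis S k (∀ i, Matrix (J i) (J i) k)} {ε R}
    (h : IsSymmetricSpecialFrobenius e ε R) (M : TriangulatedSurface T) (hM : M.Connected) :
    h.data.partitionFunction M = ∑ i, (R * (Fintype.card (J i) : k)) ^ M.eulerChar := by
  classical
  set w : (Σ i, J i) → k := fun u => R * (Fintype.card (J u.1) : k)
  have hw0 : ∀ i, R * (Fintype.card (J i) : k) ≠ 0 := fun i =>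
    mul_ne_zero h.R_ne_zero (Nat.cast_ne_zero.2 Fintype.card_ne_zero)
  have hT : Nonempty T := hM.1
  have : Finite M.Vertex := Quot.finite _
  have : Fintype M.Vertex := Fintype.ofFinite _
  rw [h.data.partitionFunction_eq_changeStates
    (fun a (x : (Σ i, J i) × (Σ i, J i)) => Matrix.blockDiagonal' (e a) x.1 x.2)
    (fun x y z => if x.2 = y.1 ∧ y.2 = z.1 ∧ z.2 = x.1 then w x.1 else 0)
    (fun x y => if x.1 = y.2 ∧ x.2 = y.1 ∧ x.1.1 = x.2.1 then (w x.1)⁻¹ else 0) ?_ ?_ M]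
  · rw [← Fintype.sum_of_injective (M.vertexStates (J := J)) M.vertexStates_injective
      (fun v => (R * (Fintype.card (J v.1) : k)) ^ Fintype.card T *
        ((R * (Fintype.card (J v.1) : k))⁻¹) ^ M.edges.card)]
    · rw [Fintype.sum_sigma, Finset.mul_sum]
      refine Finset.sum_congr rfl fun i _ => ?_
      have hi := hw0 i
      change R ^ _ * ∑ _v : M.Vertex → J i, (R * (Fintype.card (J i) : k)) ^ Fintype.card T *
        ((R * (Fintype.card (J i) : k))⁻¹) ^ M.edges.card = _
      simp only [Finset.sum_const, Finset.card_univ, Fintype.card_fun, nsmul_eq_mul]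
      rw [TriangulatedSurface.eulerChar, TriangulatedSurface.numVertices, Nat.card_eq_fintype_card,
        zpow_add₀ hi, zpow_sub₀ hi, zpow_natCast, zpow_natCast, zpow_natCast, mul_pow,
        Nat.cast_pow, inv_pow]
      field_simp
      ring
    -- A state with nonzero weight satisfies all the delta conditions, and so comes from a vertex
    -- labelling.
    · intro τ hτ
      by_contra hne
      have hC := fun t => ite_ne_right_iff.1
        (Finset.prod_ne_zero_iff.1 (left_ne_zero_of_mul hne) t (Finset.mem_univ _))
      have hB := fun E => ite_ne_right_iff.1
        (Finset.prod_ne_zero_iff.1 (right_ne_zero_of_mul hne) E (Finset.mem_univ _))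
      have hB' : ∀ s, (τ (M.glue s)).2 = (τ s).1 ∧ (τ s).1.1 = (τ s).2.1 := by
        intro s
        obtain ⟨⟨h1, h2, h3⟩, -⟩ := hB ⟨_, M.mk_mem_edges s⟩
        rcases M.side_mk s with hs | hs
        · rw [hs] at h1 h2 h3
          exact ⟨h1.symm, h3⟩
        -- Here `s` is the other side of its edge, so the conditions are those of `M.glue s` with
        -- the roles exchanged.
        · rw [hs] at h1 h2
          have hs' : M.side ⟨_, M.mk_mem_edges s⟩ = M.glue s :=
            (M.glue_glue _).symm.trans (congrArg M.glue hs)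
          rw [hs'] at h1 h2 h3
          exact ⟨h2, by rw [← h2, ← h1, h3]⟩
      refine hτ (M.exists_vertexStates hM τ ?_ (fun s => (hB' s).1) fun s => (hB' s).2)
      rintro ⟨t, j⟩
      obtain ⟨⟨h1, h2, h3⟩, -⟩ := hC t
      fin_cases j
      · exact h1
      · exact h2
      · exact h3
    · rintro ⟨i, v⟩
      have hprodC : ∀ t : T, (if (M.vertexStates ⟨i, v⟩ (t, 0)).2 = (M.vertexStates ⟨i, v⟩ (t, 1)).1 ∧
          (M.vertexStates ⟨i, v⟩ (t, 1)).2 = (M.vertexStates ⟨i, v⟩ (t, 2)).1 ∧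
          (M.vertexStates ⟨i, v⟩ (t, 2)).2 = (M.vertexStates ⟨i, v⟩ (t, 0)).1
          then w (M.vertexStates ⟨i, v⟩ (t, 0)).1 else 0) = R * (Fintype.card (J i) : k) :=
        fun t => if_pos ⟨rfl, rfl, rfl⟩
      have hglue : ∀ s, (M.vertexStates ⟨i, v⟩ s).1 = (M.vertexStates ⟨i, v⟩ (M.glue s)).2 := by
        intro s
        simp only [TriangulatedSurface.vertexStates]
        rw [Quot.sound (show M.CornerRel s ((M.glue s).1, (M.glue s).2 + 1) from rfl)]
      have hprodB : ∀ E : M.edges, (if (M.vertexStates ⟨i, v⟩ (M.side E)).1 =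
            (M.vertexStates ⟨i, v⟩ (M.glue (M.side E))).2 ∧ (M.vertexStates ⟨i, v⟩ (M.side E)).2 =
            (M.vertexStates ⟨i, v⟩ (M.glue (M.side E))).1 ∧
            (M.vertexStates ⟨i, v⟩ (M.side E)).1.1 = (M.vertexStates ⟨i, v⟩ (M.side E)).2.1
          then (w (M.vertexStates ⟨i, v⟩ (M.side E)).1)⁻¹ else 0) =
          (R * (Fintype.card (J i) : k))⁻¹ := by
        refine fun E => if_pos ⟨hglue _, ?_, rfl⟩
        rw [hglue (M.glue _), M.glue_glue]
      simp only [hprodC, hprodB]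
      rw [Finset.prod_const, Finset.prod_const, Finset.card_univ, Finset.card_univ,
        Fintype.card_coe]
  · intro a b c
    change ε (e a * e b * e c) = _
    rw [h.form_eq_sum_blockDiagonal]
    -- The three deltas leave a cyclic sum over three indices, which is the weighted trace of the
    -- product of the three block matrices.
    simp only [Fintype.sum_prod_type, ite_and, mul_ite, mul_zero, Finset.sum_ite_irrel,
      Finset.sum_const_zero, Finset.sum_ite_eq, Finset.sum_ite_eq', Finset.mem_univ, if_true]
    refine Finset.sum_congr rfl fun p _ => ?_
    have hmul : Matrix.blockDiagonal' (e a * e b * e c) = Matrix.blockDiagonal' (e a) *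
        Matrix.blockDiagonal' (e b) * Matrix.blockDiagonal' (e c) := by
      rw [← Matrix.blockDiagonal'_mul, ← Matrix.blockDiagonal'_mul]
      rfl
    rw [hmul, Matrix.mul_apply, Finset.mul_sum, Finset.sum_comm]
    refine Finset.sum_congr rfl fun s _ => ?_
    rw [Matrix.mul_apply, Finset.sum_mul, Finset.mul_sum]
    exact Finset.sum_congr rfl fun q _ => by ring
  · intro x y
    exact (h.sum_blockDiagonal_mul x.1 x.2 y.1 y.2).symm

/-! ### Frobenius' theorem on real division algebras -/

section RealDivisionAlgebra

variable {D : Type*} [DivisionRing D] [Algebra ℝ D]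

/-- Completing the square in the minimal polynomial over `ℝ`. -/
theorem exists_sub_smul_mul_self [FiniteDimensional ℝ D] (x : D) :
    ∃ a c : ℝ, (x - a • 1) * (x - a • 1) = c • (1 : D) := by
  have hint : IsIntegral ℝ x := Algebra.IsIntegral.isIntegral x
  have hirr := minpoly.irreducible hint
  have hdeg : (minpoly ℝ x).natDegree < 3 := by
    have : (minpoly ℝ x).natDegree ≤ 2 :=
      Polynomial.natDegree_le_of_degree_le hirr.degree_le_two
    omega
  have hne : minpoly ℝ x ≠ 0 := minpoly.ne_zero hint
  have h0 := minpoly.aeval ℝ x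
  rw [Polynomial.aeval_eq_sum_range' hdeg] at h0
  simp only [Finset.sum_range_succ, Finset.sum_range_zero, zero_add, pow_zero, pow_one] at h0
  set c0 := (minpoly ℝ x).coeff 0 with hc0
  set c1 := (minpoly ℝ x).coeff 1 with hc1
  set c2 := (minpoly ℝ x).coeff 2 with hc2
  rw [sq] at h0
  by_cases h2 : c2 = 0
  · by_cases h1 : c1 = 0
    · exfalso
      rw [h1, h2] at h0
      have h00 : c0 = 0 := by simpa using h0
      apply hne
      ext n
      rw [Polynomial.coeff_zero]
      rcases n with _ | _ | _ | n
      · exact h00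
      · exact h1
      · exact h2
      · exact Polynomial.coeff_eq_zero_of_natDegree_lt (by omega)
    · refine ⟨-c0 / c1, 0, ?_⟩
      have : x = (-c0 / c1) • (1 : D) := by
        rw [h2, zero_smul, add_zero] at h0
        have h3 : c1⁻¹ • (c0 • (1 : D) + c1 • x) = 0 := by rw [h0, smul_zero]
        rw [smul_add, smul_smul, smul_smul, inv_mul_cancel₀ h1, one_smul] at h3
        rw [eq_neg_of_add_eq_zero_right h3, ← neg_smul]
        congr 1
        ring
      rw [← this]; simp
  -- Centre and discriminant of the quadratic `c2 x² + c1 x + c0 = 0`.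
  · refine ⟨-c1 / (2 * c2), (c1 / (2 * c2)) ^ 2 - c0 / c2, ?_⟩
    have h3 : c2⁻¹ • (c0 • (1 : D) + c1 • x + c2 • (x * x)) = 0 := by rw [h0, smul_zero]
    rw [smul_add, smul_add, smul_smul, smul_smul, smul_smul, inv_mul_cancel₀ h2, one_smul] at h3
    rw [sub_mul, mul_sub, mul_sub, eq_neg_of_add_eq_zero_right h3]
    simp only [mul_smul_comm, smul_mul_assoc, mul_one, one_mul]
    match_scalars <;> field_simp <;> ring

/-- A subfield generated by a square root of `-1` is its own centraliser. -/
theorem eq_add_smul_of_commute [FiniteDimensional ℝ D] {i x : D} (hi : i * i = -1)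
    (hx : Commute x i) : ∃ a b : ℝ, x = a • 1 + b • i := by
  obtain ⟨a, c, h⟩ := exists_sub_smul_mul_self x
  rcases le_total 0 c with hc | hc
  · have h1 : (x - a • 1) * (x - a • 1) = (√c • (1 : D)) * (√c • (1 : D)) := by
      rw [h, smul_mul_smul_comm, Real.mul_self_sqrt hc, one_mul]
    have hcomm : Commute (x - a • 1) (√c • (1 : D)) := (Commute.one_right _).smul_right _
    rcases hcomm.mul_self_eq_mul_self_iff.1 h1 with h2 | h2
    · exact ⟨a + √c, 0, by rw [sub_eq_iff_eq_add.1 h2]; module⟩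
    · exact ⟨a - √c, 0, by rw [sub_eq_iff_eq_add.1 h2]; module⟩
  -- For `c ≤ 0` the square root is a real multiple of `i`. It commutes with `x - a`, so the
  -- difference of squares factorises and `D` has no zero divisors.
  · have h1 : (x - a • 1) * (x - a • 1) = (√(-c) • i) * (√(-c) • i) := by
      rw [h, smul_mul_smul_comm, Real.mul_self_sqrt (by linarith), hi]
      module
    have hcomm : Commute (x - a • 1) (√(-c) • i) :=
      (hx.sub_left ((Commute.one_left i).smul_left a)).smul_right _
    rcases hcomm.mul_self_eq_mul_self_iff.1 h1 with h2 | h2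
    · exact ⟨a, √(-c), by rw [sub_eq_iff_eq_add.1 h2]; module⟩
    · exact ⟨a, -√(-c), by rw [sub_eq_iff_eq_add.1 h2]; module⟩

theorem smul_one_or_exists_mul_self_eq_neg_one [FiniteDimensional ℝ D] (x : D) :
    (∃ a : ℝ, x = a • 1) ∨ ∃ i : D, i * i = -1 := by
  obtain ⟨a, c, h⟩ := exists_sub_smul_mul_self x
  rcases le_or_gt 0 c with hc | hc
  · left
    have h1 : (x - a • 1) * (x - a • 1) = (√c • (1 : D)) * (√c • (1 : D)) := by
      rw [h, smul_mul_smul_comm, Real.mul_self_sqrt hc, one_mul]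
    have hcomm : Commute (x - a • 1) (√c • (1 : D)) := (Commute.one_right _).smul_right _
    rcases hcomm.mul_self_eq_mul_self_iff.1 h1 with h2 | h2
    · exact ⟨a + √c, by rw [sub_eq_iff_eq_add.1 h2]; module⟩
    · exact ⟨a - √c, by rw [sub_eq_iff_eq_add.1 h2]; module⟩
  · right
    refine ⟨(√(-c))⁻¹ • (x - a • 1), ?_⟩
    have h0 : √(-c) * √(-c) = -c := Real.mul_self_sqrt (by linarith)
    rw [smul_mul_smul_comm, h, smul_smul, ← mul_inv, h0]
    have : (-c)⁻¹ * c = -1 := by rw [inv_neg, neg_mul, inv_mul_cancel₀ hc.ne]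
    rw [this, neg_one_smul]

/-- An element that anticommutes with a square root of `-1` is, up to a real factor, itself a
square root of `-1`. -/
theorem exists_smul_mul_self_eq_neg_one [FiniteDimensional ℝ D] {i x : D} (hi : i * i = -1)
    (hx : i * x = -(x * i)) (hx0 : x ≠ 0) : ∃ r : ℝ, (r • x) * (r • x) = -1 := by
  have hi0 : i ≠ 0 := by rintro rfl; simp at hi
  have hcomm : Commute (x * x) i := by
    have : i * (x * x) = x * x * i := by
      rw [← mul_assoc, hx, neg_mul, mul_assoc, hx, mul_neg, neg_neg, mul_assoc]
    exact this.symm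
  obtain ⟨a, b, hab⟩ := eq_add_smul_of_commute hi hcomm
  have hxx : x * (x * x) = x * x * x := (mul_assoc _ _ _).symm
  -- `x` commutes with `x * x = a + b i` but anticommutes with `i`, so `2 b (x i) = 0`.
  have hb : b = 0 := by
    rw [hab, mul_add, add_mul, mul_smul_comm, smul_mul_assoc, mul_smul_comm, smul_mul_assoc,
      mul_one, one_mul, hx, add_right_inj, smul_neg, eq_neg_iff_add_eq_zero, ← two_smul ℝ,
      smul_smul, smul_eq_zero] at hxx
    rcases hxx with h | h
    · linarith
    · exact absurd h (mul_ne_zero hx0 hi0)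
  rw [hb, zero_smul, add_zero] at hab
  -- If `a ≥ 0` then `x = ±√a` is real, hence commutes as well as anticommutes with `i`.
  have ha : a < 0 := by
    by_contra! ha
    have h1 : x * x = (√a • (1 : D)) * (√a • (1 : D)) := by
      rw [hab, smul_mul_smul_comm, Real.mul_self_sqrt ha, one_mul]
    have h2 : Commute x i := by
      rcases ((Commute.one_right x).smul_right _).mul_self_eq_mul_self_iff.1 h1 with h2 | h2 <;>
        rw [h2]
      · exact (Commute.one_left i).smul_left _
      · exact ((Commute.one_left i).smul_left _).neg_left
    rw [← h2.eq, eq_neg_iff_add_eq_zero, ← two_smul ℝ, smul_eq_zero] at hx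
    rcases hx with h | h
    · norm_num at h
    · exact mul_ne_zero hx0 hi0 h
  refine ⟨(√(-a))⁻¹, ?_⟩
  have h0 : √(-a) * √(-a) = -a := Real.mul_self_sqrt (by linarith)
  rw [smul_mul_smul_comm, hab, smul_smul, ← mul_inv, h0]
  have : (-a)⁻¹ * a = -1 := by rw [inv_neg, neg_mul, inv_mul_cancel₀ ha.ne]
  rw [this, neg_one_smul]

/-- **Frobenius' theorem**: the finite-dimensional division algebras over `ℝ` are `ℝ`, `ℂ`
and `ℍ`. -/
theorem exists_algEquiv_divType [FiniteDimensional ℝ D] :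
    ∃ d : DivType, Nonempty (D ≃ₐ[ℝ] d.Carrier) := by
  by_cases hreal : ∀ x : D, ∃ a : ℝ, x = a • 1
  · refine ⟨.real, ⟨(AlgEquiv.ofBijective (Algebra.ofId ℝ D) ⟨(algebraMap ℝ D).injective, ?_⟩).symm⟩⟩
    intro x
    obtain ⟨a, rfl⟩ := hreal x
    exact ⟨a, Algebra.algebraMap_eq_smul_one a⟩
  push Not at hreal
  obtain ⟨x, hx⟩ := hreal
  obtain ⟨a, ha⟩ | ⟨i, hi⟩ := smul_one_or_exists_mul_self_eq_neg_one x
  · exact absurd ha (hx a)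
  by_cases hcomm : ∀ y : D, Commute y i
  · refine ⟨.complex, ⟨(AlgEquiv.ofBijective (Complex.liftAux i hi)
      ⟨(Complex.liftAux i hi).toRingHom.injective, ?_⟩).symm⟩⟩
    intro y
    obtain ⟨a, b, rfl⟩ := eq_add_smul_of_commute hi (hcomm y)
    exact ⟨⟨a, b⟩, by simp [Complex.liftAux_apply, Algebra.algebraMap_eq_smul_one]⟩
  push Not at hcomm
  obtain ⟨y, hy⟩ := hcomm
  -- Conjugation by `i` is an involution: `z` is half the sum of `z - i z i`, which commutes with
  -- `i`, and `z + i z i`, which anticommutes with it.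
  have hanti : ∀ z : D, i * (z + i * z * i) = -((z + i * z * i) * i) := by
    intro z
    calc i * (z + i * z * i) = i * z + (i * i) * z * i := by noncomm_ring
      _ = -(z * i + i * z * (i * i)) := by rw [hi]; noncomm_ring
      _ = _ := by noncomm_ring
  have hcent : ∀ z : D, Commute (z - i * z * i) i := by
    intro z
    change _ * _ = _ * _
    calc (z - i * z * i) * i = z * i - i * z * (i * i) := by noncomm_ring
      _ = i * z - (i * i) * z * i := by rw [hi]; noncomm_ring
      _ = _ := by noncomm_ring
  have hy0 : y + i * y * i ≠ 0 := by
    intro h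
    apply hy
    have h1 : i * (y + i * y * i) = 0 := by rw [h, mul_zero]
    have h2 : i * (y + i * y * i) = i * y + (i * i) * y * i := by noncomm_ring
    rw [h2, hi, neg_one_mul, neg_mul, ← sub_eq_add_neg, sub_eq_zero] at h1
    exact h1.symm
  obtain ⟨r, hr⟩ := exists_smul_mul_self_eq_neg_one hi (hanti y) hy0
  set j := r • (y + i * y * i) with hj
  have hij : j * i = -(i * j) := by
    rw [hj, smul_mul_assoc, mul_smul_comm, hanti, smul_neg, neg_neg]
  let q : QuaternionAlgebra.Basis D (-1 : ℝ) 0 (-1) :=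
    { i := i, j := j, k := i * j
      i_mul_i := by rw [hi]; simp
      j_mul_j := by rw [hr]; simp
      i_mul_j := rfl
      j_mul_i := by rw [hij]; simp }
  let f : Quaternion ℝ →ₐ[ℝ] D := q.liftHom
  refine ⟨.quaternion, ⟨(AlgEquiv.ofBijective f ⟨f.toRingHom.injective, ?_⟩).symm⟩⟩
  intro z
  obtain ⟨a, b, hab⟩ := eq_add_smul_of_commute hi (hcent z)
  -- A product of two elements anticommuting with `i` commutes with `i`, so it lies in `ℝ + ℝ i`;
  -- multiplying back by `-j` puts the anticommuting part in `ℝ j + ℝ i j`.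
  have hz : Commute ((z + i * z * i) * j) i := by
    change _ * _ = _ * _
    rw [mul_assoc, hij, ← mul_assoc, hanti, mul_neg, neg_mul, mul_assoc, mul_assoc]
  obtain ⟨c, d, hcd⟩ := eq_add_smul_of_commute hi hz
  have h1 : z + i * z * i = -(c • j + d • (i * j)) := by
    have : z + i * z * i = -((z + i * z * i) * j * j) := by
      rw [mul_assoc (z + _) j j, hr, mul_neg_one, neg_neg]
    rw [this, hcd, add_mul, smul_mul_assoc, smul_mul_assoc, one_mul]
  have h2 : z = (1 / 2 : ℝ) • (a • (1 : D) + b • i - (c • j + d • (i * j))) := by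
    rw [sub_eq_add_neg, ← h1, ← hab]
    module
  refine ⟨⟨a / 2, b / 2, -c / 2, -d / 2⟩, ?_⟩
  change q.lift _ = z
  rw [h2]
  simp only [QuaternionAlgebra.Basis.lift, Algebra.algebraMap_eq_smul_one, q]
  module

end RealDivisionAlgebra

/-! ### Existence of the decompositions -/

theorem IsSymmetricSpecialFrobenius.exists_isComplexDecomposition {A S : Type*} [Ring A]
    [Algebra ℂ A] [Fintype S] [DecidableEq S] {e : Module.Basis S ℂ A} {ε : A →ₗ[ℂ] ℂ} {R : ℂ}
    (h : IsSymmetricSpecialFrobenius e ε R) :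
    ∃ (N : ℕ) (n : Fin N → ℕ), IsComplexDecomposition A n := by
  have : Module.Finite ℂ A := Module.Finite.of_basis e
  have := h.isSemisimpleRing
  obtain ⟨N, n, hn, hA⟩ := IsSemisimpleRing.exists_algEquiv_pi_matrix_of_isAlgClosed ℂ A
  exact ⟨N, n, fun i => (hn i).one_le, hA⟩

theorem IsSymmetricSpecialFrobenius.exists_isRealDecomposition {A S : Type*} [Ring A]
    [Algebra ℝ A] [Fintype S] [DecidableEq S] {e : Module.Basis S ℝ A} {ε : A →ₗ[ℝ] ℝ} {R : ℝ}
    (h : IsSymmetricSpecialFrobenius e ε R) :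
    ∃ (N : ℕ) (n : Fin N → ℕ) (D : Fin N → DivType), IsRealDecomposition A n D := by
  have : Module.Finite ℝ A := Module.Finite.of_basis e
  have := h.isSemisimpleRing
  obtain ⟨N, D, n, _, _, _, hn, ⟨f⟩⟩ :=
    IsSemisimpleRing.exists_algEquiv_pi_matrix_divisionRing_finite ℝ A
  choose d hd using fun i => exists_algEquiv_divType (D := D i)
  exact ⟨N, n, d, fun i => (hn i).one_le,
    ⟨f.trans (AlgEquiv.piCongrRight fun i => (hd i).some.mapMatrix)⟩⟩

/-! ### Complexification of the real decompositions -/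

/-- The number of simple factors of `ℂ ⊗ D`. -/
def DivType.copies : DivType → ℕ
  | real => 1
  | complex => 2
  | quaternion => 1

/-- The size of the matrices in the simple factors of `ℂ ⊗ D`. -/
def DivType.size : DivType → ℕ
  | real => 1
  | complex => 1
  | quaternion => 2

/-- The embedding of `D` into its complexification, for `D = ℂ`. -/
noncomputable def complexToMatrix : ℂ →ₐ[ℝ] (Fin 2 → Matrix (Fin 1) (Fin 1) ℂ) :=
  -- Sending `i` to `(i, -i)` makes the map `z ↦ (z, star z)`.
  Complex.liftAux ![Complex.I • 1, -Complex.I • 1] <| by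
    funext k
    fin_cases k <;> simp [smul_smul]

theorem complexToMatrix_zero (z : ℂ) : complexToMatrix z 0 0 0 = z := by
  rw [complexToMatrix, Complex.liftAux_apply, Pi.add_apply, Pi.smul_apply, Pi.algebraMap_apply]
  apply Complex.ext <;> simp [Algebra.algebraMap_eq_smul_one]

theorem complexToMatrix_one (z : ℂ) : complexToMatrix z 1 0 0 = star z := by
  rw [complexToMatrix, Complex.liftAux_apply, Pi.add_apply, Pi.smul_apply, Pi.algebraMap_apply]
  apply Complex.ext <;> simp [Algebra.algebraMap_eq_smul_one]

/-- The quaternionic basis of the algebra of complex `2 × 2` matrices. -/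
noncomputable def matrixQuaternionBasis :
    QuaternionAlgebra.Basis (Fin 1 → Matrix (Fin 2) (Fin 2) ℂ) (-1 : ℝ) 0 (-1) where
  i := fun _ => !![Complex.I, 0; 0, -Complex.I]
  j := fun _ => !![0, 1; -1, 0]
  k := fun _ => !![0, Complex.I; Complex.I, 0]
  i_mul_i := by
    funext _
    ext a b
    fin_cases a <;> fin_cases b <;> simp
  j_mul_j := by
    funext _
    ext a b
    fin_cases a <;> fin_cases b <;> simp
  i_mul_j := by
    funext _
    ext a b
    fin_cases a <;> fin_cases b <;> simp
  j_mul_i := by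
    funext _
    ext a b
    fin_cases a <;> fin_cases b <;> simp

/-- The embedding of `D` into its complexification, a direct sum of matrix algebras. -/
noncomputable def DivType.complexify : (d : DivType) →
    d.Carrier →ₐ[ℝ] (Fin d.copies → Matrix (Fin d.size) (Fin d.size) ℂ)
  | real => show ℝ →ₐ[ℝ] (Fin 1 → Matrix (Fin 1) (Fin 1) ℂ) from Algebra.ofId ℝ _
  | complex => complexToMatrix
  | quaternion => matrixQuaternionBasis.liftHom

/-- This expresses that `ℂ ⊗ D` is the target algebra without using tensor products. The inverses
come from solving the real linear equations for the entries. -/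
theorem DivType.complexify_bijective (d : DivType) :
    Function.Bijective fun x : d.Carrier × d.Carrier =>
      d.complexify x.1 + Complex.I • d.complexify x.2 := by
  rw [Function.bijective_iff_has_inverse]
  cases d with
  | real =>
    refine ⟨fun m : Fin 1 → Matrix (Fin 1) (Fin 1) ℂ => show ℝ × ℝ from
      ((m 0 0 0).re, (m 0 0 0).im), ?_, ?_⟩
    · rintro ⟨x, y⟩
      change ℝ at x y
      change (((Algebra.ofId ℝ (Fin 1 → Matrix (Fin 1) (Fin 1) ℂ) x + Complex.I •
        Algebra.ofId ℝ (Fin 1 → Matrix (Fin 1) (Fin 1) ℂ) y) 0 0 0).re,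
        ((Algebra.ofId ℝ (Fin 1 → Matrix (Fin 1) (Fin 1) ℂ) x + Complex.I •
        Algebra.ofId ℝ (Fin 1 → Matrix (Fin 1) (Fin 1) ℂ) y) 0 0 0).im) = (x, y)
      simp [Algebra.ofId_apply, Algebra.algebraMap_eq_smul_one]
    · intro m
      change Fin 1 → Matrix (Fin 1) (Fin 1) ℂ at m
      change (Algebra.ofId ℝ (Fin 1 → Matrix (Fin 1) (Fin 1) ℂ) (m 0 0 0).re + Complex.I •
        Algebra.ofId ℝ (Fin 1 → Matrix (Fin 1) (Fin 1) ℂ) (m 0 0 0).im) = m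
      funext a
      ext b c
      obtain rfl := Subsingleton.elim a 0
      obtain rfl := Subsingleton.elim b 0
      obtain rfl := Subsingleton.elim c 0
      apply Complex.ext <;> simp [Algebra.ofId_apply, Algebra.algebraMap_eq_smul_one]
  | complex =>
    refine ⟨fun m : Fin 2 → Matrix (Fin 1) (Fin 1) ℂ => show ℂ × ℂ from
      (⟨((m 0 0 0).re + (m 1 0 0).re) / 2, ((m 0 0 0).im - (m 1 0 0).im) / 2⟩,
        ⟨((m 0 0 0).im + (m 1 0 0).im) / 2, ((m 1 0 0).re - (m 0 0 0).re) / 2⟩), ?_, ?_⟩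
    · rintro ⟨x, y⟩
      change ℂ at x y
      set m := complexToMatrix x + Complex.I • complexToMatrix y with hm
      change ((⟨((m 0 0 0).re + (m 1 0 0).re) / 2, ((m 0 0 0).im - (m 1 0 0).im) / 2⟩,
        ⟨((m 0 0 0).im + (m 1 0 0).im) / 2, ((m 1 0 0).re - (m 0 0 0).re) / 2⟩) : ℂ × ℂ) = (x, y)
      have h0 : m 0 0 0 = x + Complex.I * y := by
        apply Complex.ext <;>
          simp [hm, complexToMatrix_zero]
      have h1 : m 1 0 0 = star x + Complex.I * star y := by
        apply Complex.ext <;>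
          simp [hm, complexToMatrix_one]
      rw [h0, h1]
      refine Prod.ext ?_ ?_ <;> apply Complex.ext <;> simp <;> ring
    · intro m
      change Fin 2 → Matrix (Fin 1) (Fin 1) ℂ at m
      change (complexToMatrix ⟨((m 0 0 0).re + (m 1 0 0).re) / 2,
        ((m 0 0 0).im - (m 1 0 0).im) / 2⟩ + Complex.I • complexToMatrix
        ⟨((m 0 0 0).im + (m 1 0 0).im) / 2, ((m 1 0 0).re - (m 0 0 0).re) / 2⟩) = m
      funext a
      ext b c
      obtain rfl := Subsingleton.elim b 0
      obtain rfl := Subsingleton.elim c 0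
      fin_cases a <;> apply Complex.ext <;>
        simp [complexToMatrix_zero, complexToMatrix_one] <;> ring
  | quaternion =>
    refine ⟨fun m : Fin 1 → Matrix (Fin 2) (Fin 2) ℂ => show Quaternion ℝ × Quaternion ℝ from
      (⟨((m 0 0 0).re + (m 0 1 1).re) / 2, ((m 0 0 0).im - (m 0 1 1).im) / 2,
        ((m 0 0 1).re - (m 0 1 0).re) / 2, ((m 0 0 1).im + (m 0 1 0).im) / 2⟩,
        ⟨((m 0 0 0).im + (m 0 1 1).im) / 2, ((m 0 1 1).re - (m 0 0 0).re) / 2,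
        ((m 0 0 1).im - (m 0 1 0).im) / 2, -((m 0 0 1).re + (m 0 1 0).re) / 2⟩), ?_, ?_⟩
    · rintro ⟨x, y⟩
      change Quaternion ℝ at x y
      set m := matrixQuaternionBasis.liftHom x + Complex.I • matrixQuaternionBasis.liftHom y with hm
      change ((⟨((m 0 0 0).re + (m 0 1 1).re) / 2, ((m 0 0 0).im - (m 0 1 1).im) / 2,
        ((m 0 0 1).re - (m 0 1 0).re) / 2, ((m 0 0 1).im + (m 0 1 0).im) / 2⟩,
        ⟨((m 0 0 0).im + (m 0 1 1).im) / 2, ((m 0 1 1).re - (m 0 0 0).re) / 2,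
        ((m 0 0 1).im - (m 0 1 0).im) / 2, -((m 0 0 1).re + (m 0 1 0).re) / 2⟩) :
        Quaternion ℝ × Quaternion ℝ) = (x, y)
      refine Prod.ext ?_ ?_ <;> apply QuaternionAlgebra.ext <;>
        simp [hm, QuaternionAlgebra.Basis.liftHom, QuaternionAlgebra.Basis.lift,
          matrixQuaternionBasis, Algebra.algebraMap_eq_smul_one] <;> ring
    · intro m
      change Fin 1 → Matrix (Fin 2) (Fin 2) ℂ at m
      change (matrixQuaternionBasis.liftHom
        ⟨((m 0 0 0).re + (m 0 1 1).re) / 2, ((m 0 0 0).im - (m 0 1 1).im) / 2,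
        ((m 0 0 1).re - (m 0 1 0).re) / 2, ((m 0 0 1).im + (m 0 1 0).im) / 2⟩ +
        Complex.I • matrixQuaternionBasis.liftHom
        ⟨((m 0 0 0).im + (m 0 1 1).im) / 2, ((m 0 1 1).re - (m 0 0 0).re) / 2,
        ((m 0 0 1).im - (m 0 1 0).im) / 2, -((m 0 0 1).re + (m 0 1 0).re) / 2⟩) = m
      funext a
      ext b c
      obtain rfl := Subsingleton.elim a 0
      fin_cases b <;> fin_cases c <;> apply Complex.ext <;>
        simp [QuaternionAlgebra.Basis.liftHom, QuaternionAlgebra.Basis.lift,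
          matrixQuaternionBasis, Algebra.algebraMap_eq_smul_one] <;> ring

/-- A real basis of `A` is a complex basis of the complexification of `A`. -/
theorem exists_basis_of_complexification {A P S : Type*} [Ring A] [Algebra ℝ A] [Ring P]
    [Algebra ℂ P] [Algebra ℝ P] [IsScalarTower ℝ ℂ P] [Fintype S] (ψ : A →ₐ[ℝ] P)
    (hψ : Function.Bijective fun x : A × A => ψ x.1 + Complex.I • ψ x.2)
    (e : Module.Basis S ℝ A) : ∃ e' : Module.Basis S ℂ P, ∀ a, ψ (e a) = e' a := by
  have hs : ∀ (r : ℝ) (p : P), (r : ℂ) • p = r • p := by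
    intro r p
    rw [Algebra.smul_def, Algebra.smul_def, IsScalarTower.algebraMap_apply ℝ ℂ P]
    rfl
  -- Splitting complex coefficients into real and imaginary parts reduces independence and spanning
  -- over `ℂ` to the same facts for `e` over `ℝ`.
  have hdec : ∀ z : S → ℂ, ∑ a, z a • ψ (e a) =
      ψ (∑ a, (z a).re • e a) + Complex.I • ψ (∑ a, (z a).im • e a) := by
    intro z
    simp only [map_sum, map_smul, Finset.smul_sum, ← Finset.sum_add_distrib]
    refine Finset.sum_congr rfl fun a _ => ?_
    conv_lhs => rw [← Complex.re_add_im (z a), add_smul, mul_comm, mul_smul]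
    rw [hs, hs]
  have hli : LinearIndependent ℂ fun a => ψ (e a) := by
    rw [Fintype.linearIndependent_iff]
    intro z hz a
    rw [hdec] at hz
    have h0 := @hψ.1 (_, _) (0, 0) (hz.trans (by simp))
    rw [Prod.mk.injEq] at h0
    exact Complex.ext (Fintype.linearIndependent_iff.1 e.linearIndependent _ h0.1 a)
      (Fintype.linearIndependent_iff.1 e.linearIndependent _ h0.2 a)
  refine ⟨Module.Basis.mk hli fun p _ => ?_, fun a => by simp⟩
  obtain ⟨⟨x, y⟩, rfl⟩ := hψ.2 p
  have := hdec fun a => ⟨e.repr x a, e.repr y a⟩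
  simp only [e.sum_repr] at this
  change ψ x + _ ∈ _
  rw [← this]
  exact Submodule.sum_mem _ fun a _ => Submodule.smul_mem _ _ (Submodule.subset_span ⟨a, rfl⟩)

section Complexification

variable {N : ℕ} (n : Fin N → ℕ) (D : Fin N → DivType)

/-- The embedding of a direct sum of matrix algebras over `ℝ`, `ℂ`, `ℍ` into its
complexification. -/
noncomputable def piComplexify : (∀ i, Matrix (Fin (n i)) (Fin (n i)) (D i).Carrier) →ₐ[ℝ]
    ∀ u : Σ i, Fin (D i).copies,
      Matrix (Fin (n u.1) × Fin (D u.1).size) (Fin (n u.1) × Fin (D u.1).size) ℂ :=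
  AlgHom.pi fun u => ((Matrix.compAlgEquiv (Fin (n u.1)) (Fin (D u.1).size) ℂ ℝ).toAlgHom.comp
    (((Pi.evalAlgHom ℝ _ u.2).comp (D u.1).complexify).mapMatrix)).comp (Pi.evalAlgHom ℝ _ u.1)

/-- Each entry in `D i` is complexified separately, so this is `complexify_bijective` applied entry
by entry. -/
theorem piComplexify_bijective :
    Function.Bijective fun x : (∀ i, Matrix (Fin (n i)) (Fin (n i)) (D i).Carrier) ×
        (∀ i, Matrix (Fin (n i)) (Fin (n i)) (D i).Carrier) =>
      piComplexify n D x.1 + Complex.I • piComplexify n D x.2 := by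
  constructor
  · rintro ⟨x, y⟩ ⟨x', y'⟩ h
    have key : ∀ i a b, (x i a b, y i a b) = (x' i a b, y' i a b) := by
      intro i a b
      refine (D i).complexify_bijective.1 ?_
      funext k
      ext l m
      exact congrFun (congrFun (congrFun h ⟨i, k⟩) (a, l)) (b, m)
    refine Prod.ext ?_ ?_ <;> funext i <;> ext a b
    · exact congrArg Prod.fst (key i a b)
    · exact congrArg Prod.snd (key i a b)
  · intro m
    choose f hf using fun i (a b : Fin (n i)) =>
      (D i).complexify_bijective.2 fun k => Matrix.of fun l l' => m ⟨i, k⟩ (a, l) (b, l')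
    refine ⟨(fun i => Matrix.of fun a b => (f i a b).1, fun i => Matrix.of fun a b =>
      (f i a b).2), ?_⟩
    funext ⟨i, k⟩
    ext ⟨a, l⟩ ⟨b, l'⟩
    exact congrFun (congrFun (congrFun (hf i a b) k) l) l'

end Complexification

/-! ### The genus formulas -/

theorem IsSymmetricSpecialFrobenius.partitionFunction_complex {A S T : Type*} [Ring A]
    [Algebra ℂ A] [Fintype S] [DecidableEq S] [Fintype T] {e : Module.Basis S ℂ A}
    {ε : A →ₗ[ℂ] ℂ} {R : ℂ} (h : IsSymmetricSpecialFrobenius e ε R) {N : ℕ} {n : Fin N → ℕ}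
    (hA : IsComplexDecomposition A n) {g : ℕ} {M : TriangulatedSurface T} (hM : M.IsGenus g) :
    h.data.partitionFunction M =
      R ^ (2 - 2 * (g : ℤ)) * ∑ i, (n i : ℂ) ^ (2 - 2 * (g : ℤ)) := by
  obtain ⟨hn, ⟨φ⟩⟩ := hA
  have : ∀ i, Nonempty (Fin (n i)) := fun i => ⟨⟨0, hn i⟩⟩
  have hφ : ∀ a, φ.toAlgHom (e a) = e.map φ.toLinearEquiv a := fun a => by simp
  have h1 := h.partitionFunction_extend hφ M
  rw [(h.extend hφ).partitionFunction_pi_matrix M hM.1, hM.2] at h1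
  simp only [Algebra.algebraMap_self, RingHom.id_apply, Fintype.card_fin, mul_zpow] at h1
  rw [← h1, Finset.mul_sum]

/-- Complexifying `M_n(D)` gives `copies` blocks of size `n * size`; the part of their contribution
independent of `R` and `n` is `f(i, g)`. -/
theorem DivType.copies_mul_size_zpow (d : DivType) (g : ℕ) :
    (d.copies : ℝ) * (d.size : ℝ) ^ (2 - 2 * (g : ℤ)) = d.factor g := by
  cases d <;> simp [copies, size, factor]

theorem IsSymmetricSpecialFrobenius.partitionFunction_real {A S T : Type*} [Ring A]
    [Algebra ℝ A] [Fintype S] [DecidableEq S] [Fintype T] {e : Module.Basis S ℝ A}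
    {ε : A →ₗ[ℝ] ℝ} {R : ℝ} (h : IsSymmetricSpecialFrobenius e ε R) {N : ℕ} {n : Fin N → ℕ}
    {D : Fin N → DivType} (hA : IsRealDecomposition A n D) {g : ℕ} {M : TriangulatedSurface T}
    (hM : M.IsGenus g) :
    h.data.partitionFunction M = R ^ (2 - 2 * (g : ℤ)) *
      ∑ i, (D i).factor g * (n i : ℝ) ^ (2 - 2 * (g : ℤ)) := by
  obtain ⟨hn, ⟨φ⟩⟩ := hA
  have hne : ∀ u : Σ i, Fin (D i).copies, Nonempty (Fin (n u.1) × Fin (D u.1).size) := by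
    rintro ⟨i, _⟩
    refine ⟨⟨0, hn i⟩, ⟨0, ?_⟩⟩
    cases D i <;> simp [DivType.size]
  have hbij : Function.Bijective fun x : A × A =>
      ((piComplexify n D).comp φ.toAlgHom) x.1 +
        Complex.I • ((piComplexify n D).comp φ.toAlgHom) x.2 :=
    (piComplexify_bijective n D).comp (φ.toEquiv.prodCongr φ.toEquiv).bijective
  obtain ⟨e', he'⟩ := exists_basis_of_complexification _ hbij e
  have h1 := h.partitionFunction_extend he' M
  rw [(h.extend he').partitionFunction_pi_matrix M hM.1, hM.2, Fintype.sum_sigma] at h1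
  -- The real identity is checked in `ℂ`, where the summands for the `copies` blocks over a given
  -- `i` are equal.
  apply (algebraMap ℝ ℂ).injective
  rw [← h1, Finset.mul_sum, map_sum]
  refine Finset.sum_congr rfl fun i _ => ?_
  rw [← DivType.copies_mul_size_zpow]
  simp only [Fintype.card_prod, Fintype.card_fin, Finset.sum_const, Finset.card_univ,
    nsmul_eq_mul, map_mul, map_zpow₀, map_natCast, Nat.cast_mul, mul_zpow]
  ring

end StateSum

theorem mainTheorem5 :
    (∀ {A S : Type*} [Ring A] [Algebra ℂ A] [Fintype S] [DecidableEq S]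
        (e : Module.Basis S ℂ A) (ε : A →ₗ[ℂ] ℂ) (R : ℂ)
        (h : StateSum.IsSymmetricSpecialFrobenius e ε R),
      (∃ (N : ℕ) (n : Fin N → ℕ), StateSum.IsComplexDecomposition A n) ∧
      ∀ (N : ℕ) (n : Fin N → ℕ), StateSum.IsComplexDecomposition A n →
        ∀ (g : ℕ) {T : Type*} [Fintype T] (M : StateSum.TriangulatedSurface T), M.IsGenus g →
          h.data.partitionFunction M =
            R ^ (2 - 2 * (g : ℤ)) * ∑ i, (n i : ℂ) ^ (2 - 2 * (g : ℤ))) ∧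
    (∀ {A S : Type*} [Ring A] [Algebra ℝ A] [Fintype S] [DecidableEq S]
        (e : Module.Basis S ℝ A) (ε : A →ₗ[ℝ] ℝ) (R : ℝ)
        (h : StateSum.IsSymmetricSpecialFrobenius e ε R),
      (∃ (N : ℕ) (n : Fin N → ℕ) (D : Fin N → StateSum.DivType),
        StateSum.IsRealDecomposition A n D) ∧
      ∀ (N : ℕ) (n : Fin N → ℕ) (D : Fin N → StateSum.DivType),
        StateSum.IsRealDecomposition A n D →
        ∀ (g : ℕ) {T : Type*} [Fintype T] (M : StateSum.TriangulatedSurface T), M.IsGenus g →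
          h.data.partitionFunction M =
            R ^ (2 - 2 * (g : ℤ)) *
              ∑ i, (D i).factor g * (n i : ℝ) ^ (2 - 2 * (g : ℤ))) := by
  refine ⟨fun e ε R h => ⟨h.exists_isComplexDecomposition, fun N n hA g T _ M hM =>
    h.partitionFunction_complex hA hM⟩, fun e ε R h => ⟨h.exists_isRealDecomposition,
    fun N n D hA g T _ M hM => h.partitionFunction_real hA hM⟩⟩
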